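/- All norms are the normalized norms of $L_q(0,2\pi)$: $\|f\|_1=\frac1{2\pi}\int_0^{2\pi}|f(x)|\,dx$ and $\|f\|_\infty=\operatorname{ess\,sup}_{x\in(0,2\pi)}|f(x)|$. A real trigonometric polynomial of degree at most $n$ is a function $\sum_{k=0}^{n}(a_k\cos kx+b_k\sin kx)$ with $a_k,b_k\in\mathbb R$. There exist absolute constants $c_-,c_+,C>0$ such that for every real $\varepsilon$ with $0\le\varepsilon<1$ there is a sequence $\{p_j\}_{j=1}^\infty$ of real trigonometric polynomials with $$\deg p_j\le 2^{\,j-j^{\varepsilon}},\qquad c_-\le\|p_j\|_1\le\|p_j\|_\infty\le c_+\qquad(j=1,2,\dots)$$ and $$\Big\|\sum_{j=1}^{N}p_j(x)\cos 2^{j}x\Big\|_\infty\le C\,N^{\max(\varepsilon,\frac12)}\qquad\text{for all }N=1,2,\dots.$$ -/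

import Mathlib

open MeasureTheory

/-- `f` is a real trigonometric polynomial of degree at most `n`:
`f x = ∑_{k=0}^{n} (a_k cos (k x) + b_k sin (k x))` with real coefficients. -/
def IsRealTrigPolyOfDegreeLE (n : ℕ) (f : ℝ → ℝ) : Prop :=
  ∃ a b : ℕ → ℝ, ∀ x : ℝ,
    f x = ∑ k ∈ Finset.range (n + 1),
      (a k * Real.cos ((k : ℝ) * x) + b k * Real.sin ((k : ℝ) * x))

/-- `f` is a real trigonometric polynomial. -/
def IsRealTrigPoly (f : ℝ → ℝ) : Prop :=
  ∃ n : ℕ, IsRealTrigPolyOfDegreeLE n f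

/-- The degree of a real trigonometric polynomial: the least `n` such that `f` is a real
trigonometric polynomial of degree at most `n` (only meaningful if `IsRealTrigPoly f`). -/
noncomputable def trigDegree (f : ℝ → ℝ) : ℕ :=
  sInf {n : ℕ | IsRealTrigPolyOfDegreeLE n f}

/-- Lebesgue measure on `(0, 2π)`, normalized to total mass one. -/
noncomputable def normalizedMeasure : Measure ℝ :=
  (ENNReal.ofReal (2 * Real.pi))⁻¹ • volume.restrict (Set.Ioo 0 (2 * Real.pi))

/-- The normalized norm of `L_q(0, 2π)`, for `1 ≤ q ≤ ∞`: for finite `q` it is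
`((1 / 2π) ∫_0^{2π} |f|^q)^(1/q)`, for `q = ∞` the essential supremum of `|f|`. -/
noncomputable def trigNorm (q : ENNReal) (f : ℝ → ℝ) : ENNReal :=
  eLpNorm f q normalizedMeasure

/-! ### Closure properties of real trigonometric polynomials -/

namespace IsRealTrigPolyOfDegreeLE

/-! Put `T j = j ^ max ε (1/2)`, and let the partial sums S control themselves: the coefficient p_j
is a polynomial in an earlier sum S_m, with values in [0, 1], nearly 0 where |S_m| is close to `80 *
T j` and at least 3/5 where |S_m| ≤ `40 * T j`. The lag j - m pays for the degree of p_j, yet is at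
most `10 * T j`. So if |S_m| ≤ `70 * T j`, trivial growth keeps |S_j| ≤ `80 * T j`; otherwise p_j ≤
1/√j, and the growth of `80 * T` absorbs the new term (`abs_sum_le`). The p_j do not degenerate:
each new term is orthogonal to the preceding sum, so ∫ S_m² ≤ m ≤ (T j)² (`integral_sum_sq_le`), and
the cutoff acts only on a small set (`half_le_integral_coeff`). -/

theorem mono {n m : ℕ} {f : ℝ → ℝ} (hf : IsRealTrigPolyOfDegreeLE n f) (h : n ≤ m) :
    IsRealTrigPolyOfDegreeLE m f := by
  obtain ⟨a, b, hab⟩ := hf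
  refine ⟨fun k => if k ≤ n then a k else 0, fun k => if k ≤ n then b k else 0, fun x => ?_⟩
  rw [hab x, ← Finset.sum_subset (s₁ := Finset.range (n + 1)) (s₂ := Finset.range (m + 1))]
  · refine Finset.sum_congr rfl fun k hk => ?_
    have : k ≤ n := Nat.lt_succ_iff.1 (Finset.mem_range.1 hk)
    simp [this]
  · intro k hk
    simp only [Finset.mem_range] at hk ⊢
    omega
  · intro k _ hk
    have : ¬ k ≤ n := by
      simp only [Finset.mem_range] at hk
      omega
    simp [this]

theorem zero (n : ℕ) : IsRealTrigPolyOfDegreeLE n fun _ => 0 :=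
  ⟨0, 0, fun x => by simp⟩

theorem add {n : ℕ} {f g : ℝ → ℝ} (hf : IsRealTrigPolyOfDegreeLE n f)
    (hg : IsRealTrigPolyOfDegreeLE n g) : IsRealTrigPolyOfDegreeLE n fun x => f x + g x := by
  obtain ⟨a, b, hab⟩ := hf
  obtain ⟨c, d, hcd⟩ := hg
  refine ⟨a + c, b + d, fun x => ?_⟩
  simp only [hab, hcd, ← Finset.sum_add_distrib]
  refine Finset.sum_congr rfl fun k _ => ?_
  simp only [Pi.add_apply]
  ring

theorem const_mul {n : ℕ} {f : ℝ → ℝ} (c : ℝ) (hf : IsRealTrigPolyOfDegreeLE n f) :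
    IsRealTrigPolyOfDegreeLE n fun x => c * f x := by
  obtain ⟨a, b, hab⟩ := hf
  refine ⟨fun k => c * a k, fun k => c * b k, fun x => ?_⟩
  simp only [hab, Finset.mul_sum]
  refine Finset.sum_congr rfl fun k _ => ?_
  ring

theorem sum {ι : Type*} {n : ℕ} (s : Finset ι) {f : ι → ℝ → ℝ}
    (hf : ∀ i ∈ s, IsRealTrigPolyOfDegreeLE n (f i)) :
    IsRealTrigPolyOfDegreeLE n fun x => ∑ i ∈ s, f i x := by
  classical
  induction s using Finset.induction_on with
  | empty => simpa using zero n
  | insert i s hi ih =>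
    simp only [Finset.sum_insert hi]
    exact (hf i (Finset.mem_insert_self i s)).add
      (ih fun k hk => hf k (Finset.mem_insert_of_mem hk))

theorem cos_nat (k : ℕ) : IsRealTrigPolyOfDegreeLE k fun x => Real.cos (k * x) := by
  refine ⟨fun i => if i = k then 1 else 0, 0, fun x => ?_⟩
  simp

theorem sin_nat (k : ℕ) : IsRealTrigPolyOfDegreeLE k fun x => Real.sin (k * x) := by
  refine ⟨0, fun i => if i = k then 1 else 0, fun x => ?_⟩
  simp

theorem const (n : ℕ) (c : ℝ) : IsRealTrigPolyOfDegreeLE n fun _ => c := by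
  simpa using ((cos_nat 0).const_mul c).mono (Nat.zero_le n)

theorem cos_int {n : ℕ} (z : ℤ) (hz : z.natAbs ≤ n) :
    IsRealTrigPolyOfDegreeLE n fun x => Real.cos (z * x) := by
  rcases Int.natAbs_eq z with h | h <;> rw [h]
  · simpa using (cos_nat z.natAbs).mono hz
  · simpa using (cos_nat z.natAbs).mono hz

theorem sin_int {n : ℕ} (z : ℤ) (hz : z.natAbs ≤ n) :
    IsRealTrigPolyOfDegreeLE n fun x => Real.sin (z * x) := by
  rcases Int.natAbs_eq z with h | h <;> rw [h]
  · simpa using (sin_nat z.natAbs).mono hz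
  · simpa using ((sin_nat z.natAbs).const_mul (-1)).mono hz

theorem monomial_mul_monomial {n m k l : ℕ} (hk : k ≤ n) (hl : l ≤ m) (a b c d : ℝ) :
    IsRealTrigPolyOfDegreeLE (n + m) fun x =>
      (a * Real.cos (k * x) + b * Real.sin (k * x)) *
        (c * Real.cos (l * x) + d * Real.sin (l * x)) := by
  have h1 : ((k : ℤ) + l).natAbs ≤ n + m := by omega
  have h2 : ((k : ℤ) - l).natAbs ≤ n + m := by omega
  have := ((((cos_int _ h1).const_mul ((a * c - b * d) / 2)).add
    ((cos_int _ h2).const_mul ((a * c + b * d) / 2))).add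
    ((sin_int _ h1).const_mul ((b * c + a * d) / 2))).add
    ((sin_int _ h2).const_mul ((b * c - a * d) / 2))
  convert this using 2 with x
  push_cast
  rw [add_mul (k : ℝ), sub_mul (k : ℝ), Real.cos_add, Real.cos_sub, Real.sin_add, Real.sin_sub]
  ring

theorem mul {n m : ℕ} {f g : ℝ → ℝ} (hf : IsRealTrigPolyOfDegreeLE n f)
    (hg : IsRealTrigPolyOfDegreeLE m g) :
    IsRealTrigPolyOfDegreeLE (n + m) fun x => f x * g x := by
  obtain ⟨a, b, hab⟩ := hf
  obtain ⟨c, d, hcd⟩ := hg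
  simp only [hab, hcd, Finset.sum_mul_sum]
  refine sum _ fun k hk => sum _ fun l hl => monomial_mul_monomial ?_ ?_ _ _ _ _
  · exact Nat.lt_succ_iff.1 (Finset.mem_range.1 hk)
  · exact Nat.lt_succ_iff.1 (Finset.mem_range.1 hl)

theorem pow {n : ℕ} {f : ℝ → ℝ} (hf : IsRealTrigPolyOfDegreeLE n f) (k : ℕ) :
    IsRealTrigPolyOfDegreeLE (k * n) fun x => f x ^ k := by
  induction k with
  | zero => simpa using const 0 1
  | succ k ih => simpa only [pow_succ, Nat.succ_mul] using ih.mul hf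

theorem const_sub {n : ℕ} {f : ℝ → ℝ} (c : ℝ) (hf : IsRealTrigPolyOfDegreeLE n f) :
    IsRealTrigPolyOfDegreeLE n fun x => c - f x := by
  have := (const n c).add (hf.const_mul (-1))
  convert this using 2 with x
  ring

theorem continuous {n : ℕ} {f : ℝ → ℝ} (hf : IsRealTrigPolyOfDegreeLE n f) : Continuous f := by
  obtain ⟨a, b, hab⟩ := hf
  rw [funext hab]
  fun_prop

end IsRealTrigPolyOfDegreeLE

/-! ### The normalized measure -/

instance : IsProbabilityMeasure normalizedMeasure := by
  constructor
  rw [normalizedMeasure, Measure.smul_apply, Measure.restrict_apply_univ, Real.volume_Ioo, sub_zero,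
    smul_eq_mul]
  exact ENNReal.inv_mul_cancel (by simpa using Real.pi_pos) ENNReal.ofReal_ne_top

theorem integrable_normalizedMeasure_of_continuous {f : ℝ → ℝ} (hf : Continuous f) :
    Integrable f normalizedMeasure := by
  refine Integrable.smul_measure ?_ (by simpa using Real.pi_pos)
  exact (hf.integrableOn_Icc (a := 0) (b := 2 * Real.pi)).mono_set Set.Ioo_subset_Icc_self

theorem integral_normalizedMeasure (f : ℝ → ℝ) :
    ∫ x, f x ∂normalizedMeasure = (2 * Real.pi)⁻¹ * ∫ x in (0 : ℝ)..2 * Real.pi, f x := by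
  rw [normalizedMeasure, integral_smul_measure,
    intervalIntegral.integral_of_le Real.two_pi_pos.le, integral_Ioc_eq_integral_Ioo,
    ENNReal.toReal_inv, ENNReal.toReal_ofReal Real.two_pi_pos.le, smul_eq_mul]

theorem integral_cos_int_mul {z : ℤ} (hz : z ≠ 0) :
    ∫ x in (0 : ℝ)..2 * Real.pi, Real.cos (z * x) = 0 := by
  rw [intervalIntegral.integral_comp_mul_left _ (Int.cast_ne_zero.2 hz), integral_cos]
  have := Real.sin_int_mul_pi (z * 2)
  push_cast at this
  simp [← mul_assoc, this]

theorem integral_sin_int_mul (z : ℤ) :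
    ∫ x in (0 : ℝ)..2 * Real.pi, Real.sin (z * x) = 0 := by
  rcases eq_or_ne z 0 with rfl | hz
  · simp
  rw [intervalIntegral.integral_comp_mul_left _ (Int.cast_ne_zero.2 hz), integral_sin]
  simp [Real.cos_int_mul_two_pi z]

theorem IsRealTrigPolyOfDegreeLE.integral_mul_cos_eq_zero {n D : ℕ} {f : ℝ → ℝ}
    (hf : IsRealTrigPolyOfDegreeLE n f) (h : n < D) :
    ∫ x, f x * Real.cos (D * x) ∂normalizedMeasure = 0 := by
  obtain ⟨a, b, hab⟩ := hf
  simp only [hab, Finset.sum_mul]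
  rw [integral_finsetSum _ fun k _ => integrable_normalizedMeasure_of_continuous (by fun_prop)]
  refine Finset.sum_eq_zero fun k hk => ?_
  have hk' := Finset.mem_range.1 hk
  have e (x : ℝ) : (a k * Real.cos (k * x) + b k * Real.sin (k * x)) * Real.cos (D * x) =
      a k / 2 * Real.cos (((k + D : ℤ) : ℝ) * x) + a k / 2 * Real.cos (((k - D : ℤ) : ℝ) * x) +
      (b k / 2 * Real.sin (((k + D : ℤ) : ℝ) * x) +
        b k / 2 * Real.sin (((k - D : ℤ) : ℝ) * x)) := by
    push_cast
    rw [add_mul (k : ℝ), sub_mul (k : ℝ), Real.cos_add, Real.cos_sub, Real.sin_add, Real.sin_sub]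
    ring
  simp only [e]
  have ii (F : ℝ → ℝ) (hF : Continuous F) :
      IntervalIntegrable F volume 0 (2 * Real.pi) := hF.intervalIntegrable _ _
  rw [integral_normalizedMeasure, intervalIntegral.integral_add (ii _ (by fun_prop))
    (ii _ (by fun_prop)), intervalIntegral.integral_add (ii _ (by fun_prop)) (ii _ (by fun_prop)),
    intervalIntegral.integral_add (ii _ (by fun_prop)) (ii _ (by fun_prop))]
  simp only [intervalIntegral.integral_const_mul]
  rw [integral_cos_int_mul (by omega), integral_cos_int_mul (by omega), integral_sin_int_mul,
    integral_sin_int_mul]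
  simp

theorem trigNorm_top_le {f : ℝ → ℝ} {C : ℝ} (h : ∀ x, |f x| ≤ C) :
    trigNorm ⊤ f ≤ ENNReal.ofReal C := by
  rw [trigNorm, eLpNorm_exponent_top]
  exact eLpNormEssSup_le_of_ae_bound (Filter.Eventually.of_forall h)

theorem trigNorm_one_le_trigNorm_top {f : ℝ → ℝ} (hf : Continuous f) :
    trigNorm 1 f ≤ trigNorm ⊤ f :=
  eLpNorm_le_eLpNorm_of_exponent_le le_top hf.aestronglyMeasurable

theorem ofReal_integral_le_trigNorm_one (f : ℝ → ℝ) :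
    ENNReal.ofReal (∫ x, f x ∂normalizedMeasure) ≤ trigNorm 1 f := by
  rw [trigNorm, eLpNorm_one_eq_lintegral_enorm]
  refine le_trans ?_ (enorm_integral_le_lintegral_enorm f)
  rw [← ofReal_norm]
  exact ENNReal.ofReal_le_ofReal (le_abs_self _)

/-! ### A polynomial cutoff -/

/-- A polynomial mapping `[0, 1]` to itself that is small on `[0, 1/4]` and not small on
`[3/4, 1]`. -/
def polyCutoff (n : ℕ) (u : ℝ) : ℝ := 1 - (1 - u ^ n) ^ 2 ^ n

section polyCutoff

variable {n : ℕ} {u : ℝ}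

theorem polyCutoff_nonneg (h0 : 0 ≤ u) (h1 : u ≤ 1) : 0 ≤ polyCutoff n u :=
  sub_nonneg.2 (pow_le_one₀ (sub_nonneg.2 (pow_le_one₀ h0 h1))
    (sub_le_self _ (pow_nonneg h0 n)))

theorem polyCutoff_le_one (h0 : 0 ≤ u) (h1 : u ≤ 1) : polyCutoff n u ≤ 1 :=
  sub_le_self _ (pow_nonneg (sub_nonneg.2 (pow_le_one₀ h0 h1)) _)

theorem polyCutoff_one : polyCutoff n 1 = 1 := by
  simp [polyCutoff]

/-- Bernoulli gives `polyCutoff n u ≤ 2 ^ n * u ^ n`. -/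
theorem polyCutoff_le_of_le (h0 : 0 ≤ u) (h1 : u ≤ 1 / 4) : polyCutoff n u ≤ (1 / 2) ^ n := by
  have hu : u ^ n ≤ (1 / 4) ^ n := pow_le_pow_left₀ h0 h1 n
  have hu1 : u ^ n ≤ 1 := pow_le_one₀ h0 (by linarith)
  have hb := one_add_mul_le_pow (a := -u ^ n) (by linarith) (2 ^ n)
  rw [← sub_eq_add_neg 1 (u ^ n)] at hb
  push_cast at hb
  have : (2 : ℝ) ^ n * u ^ n ≤ (1 / 2) ^ n := by
    calc (2 : ℝ) ^ n * u ^ n ≤ 2 ^ n * (1 / 4) ^ n := by gcongr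
      _ = (1 / 2) ^ n := by rw [← mul_pow]; norm_num
  rw [polyCutoff]
  linarith

theorem le_polyCutoff_of_le (hn : n ≠ 0) (h0 : 3 / 4 ≤ u) (h1 : u ≤ 1) :
    3 / 5 ≤ polyCutoff n u := by
  have hu1 : u ^ n ≤ 1 := pow_le_one₀ (by linarith) h1
  have hu0 : 0 ≤ u ^ n := pow_nonneg (by linarith) n
  have hb := one_add_mul_le_pow (a := u ^ n) (by linarith) (2 ^ n)
  push_cast at hb
  have h2 : (3 / 2 : ℝ) ≤ 2 ^ n * u ^ n := by
    rw [← mul_pow]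
    exact (by linarith : (3 / 2 : ℝ) ≤ 2 * u).trans (le_self_pow₀ (by linarith) hn)
  -- Multiplying by `(1 + u ^ n) ^ 2 ^ n`, which is at least 5/2 by Bernoulli, forces the subtracted
  -- power to be at most 2/5.
  have hle : (1 - u ^ n) ^ 2 ^ n * (1 + u ^ n) ^ 2 ^ n ≤ 1 := by
    rw [← mul_pow]
    exact pow_le_one₀ (by nlinarith) (by nlinarith)
  have h3 : 0 ≤ (1 - u ^ n) ^ 2 ^ n := pow_nonneg (by linarith) _
  rw [polyCutoff]
  nlinarith

end polyCutoff

theorem IsRealTrigPolyOfDegreeLE.polyCutoff {d : ℕ} {f : ℝ → ℝ}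
    (hf : IsRealTrigPolyOfDegreeLE d f) (n : ℕ) :
    IsRealTrigPolyOfDegreeLE (2 ^ n * (n * d)) fun x => polyCutoff n (f x) :=
  (((hf.pow n).const_sub 1).pow (2 ^ n)).const_sub 1

/-! ### The controlled lacunary sum -/

/-- The exponent of the polynomial cutoff used for the index `j`. -/
def cutoffExponent (j : ℕ) : ℕ := j.sqrt + 1

/-- The number of earlier terms on which the coefficient of index `j` depends. -/
noncomputable def lookback (T : ℕ → ℝ) (j : ℕ) : ℕ := j - ⌈T j⌉₊ - 2 * cutoffExponent j - 4

theorem lookback_lt {T : ℕ → ℝ} {i j : ℕ} (h1 : 1 ≤ i) (h : i ≤ lookback T j) : i < j := by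
  unfold lookback at h
  omega

/-- The coefficient of `cos (2 ^ j * x)`: it switches off where the sum of the first
`lookback T j` terms is close to `80 * T j` in absolute value. -/
noncomputable def controlledCoeff (T : ℕ → ℝ) (j : ℕ) (x : ℝ) : ℝ :=
  polyCutoff (cutoffExponent j)
    (1 - ((∑ i ∈ (Finset.Icc 1 (lookback T j)).attach,
      controlledCoeff T i x * Real.cos ((2 : ℝ) ^ (i : ℕ) * x)) / (80 * T j)) ^ 2)
termination_by j
decreasing_by exact lookback_lt (Finset.mem_Icc.1 i.2).1 (Finset.mem_Icc.1 i.2).2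

/-- The lacunary sum with coefficients `controlledCoeff T`. -/
noncomputable def controlledSum (T : ℕ → ℝ) (N : ℕ) (x : ℝ) : ℝ :=
  ∑ j ∈ Finset.Icc 1 N, controlledCoeff T j x * Real.cos ((2 : ℝ) ^ j * x)

section controlled

variable {T : ℕ → ℝ}

theorem controlledCoeff_eq (T : ℕ → ℝ) (j : ℕ) (x : ℝ) :
    controlledCoeff T j x = polyCutoff (cutoffExponent j)
      (1 - (controlledSum T (lookback T j) x / (80 * T j)) ^ 2) := by
  rw [controlledCoeff, controlledSum, Finset.sum_attach _
    fun i => controlledCoeff T i x * Real.cos ((2 : ℝ) ^ i * x)]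

theorem controlledSum_zero (x : ℝ) : controlledSum T 0 x = 0 := by
  simp [controlledSum]

theorem controlledSum_succ (N : ℕ) (x : ℝ) :
    controlledSum T (N + 1) x = controlledSum T N x +
      controlledCoeff T (N + 1) x * Real.cos ((2 : ℝ) ^ (N + 1) * x) :=
  Finset.sum_Icc_succ_top (by omega) _

theorem controlledCoeff_of_lookback_eq_zero {j : ℕ} (h : lookback T j = 0) (x : ℝ) :
    controlledCoeff T j x = 1 := by
  rw [controlledCoeff_eq, h, controlledSum_zero]
  simp [polyCutoff_one]

/-- A bound for the degree of `controlledCoeff T j`. -/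
noncomputable def coeffDegree (T : ℕ → ℝ) (j : ℕ) : ℕ :=
  if lookback T j = 0 then 0 else 2 ^ (lookback T j + 2 + 2 * cutoffExponent j)

/-- This spectral gap keeps the product of `controlledSum T N` and the next coefficient below
frequency `2 ^ (N + 1)`, as orthogonality requires. -/
theorem four_mul_coeffDegree_le (T : ℕ → ℝ) (j : ℕ) :
    4 * coeffDegree T j ≤ 2 ^ j := by
  unfold coeffDegree
  split_ifs with h
  · positivity
  · rw [show 4 = 2 ^ 2 from rfl, ← pow_add]
    refine Nat.pow_le_pow_right (by norm_num) ?_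
    unfold lookback at *
    omega

theorem coeffDegree_le (T : ℕ → ℝ) (j : ℕ) :
    (coeffDegree T j : ℝ) ≤ (2 : ℝ) ^ ((j : ℝ) - T j) := by
  unfold coeffDegree
  split_ifs with h
  · simpa using (Real.rpow_pos_of_pos two_pos _).le
  · push_cast
    rw [← Real.rpow_natCast]
    refine Real.rpow_le_rpow_of_exponent_le one_le_two ?_
    have h1 : lookback T j + 2 + 2 * cutoffExponent j + ⌈T j⌉₊ ≤ j := by
      unfold lookback at *
      omega
    have h2 := Nat.le_ceil (T j)
    have h3 : ((lookback T j + 2 + 2 * cutoffExponent j : ℕ) : ℝ) + (⌈T j⌉₊ : ℝ) ≤ j := by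
      exact_mod_cast h1
    linarith

theorem isRealTrigPolyOfDegreeLE_controlledSum_of_coeff {N : ℕ}
    (h : ∀ j, 1 ≤ j → j ≤ N → IsRealTrigPolyOfDegreeLE (coeffDegree T j) (controlledCoeff T j)) :
    IsRealTrigPolyOfDegreeLE (2 ^ N + 2 ^ N / 4) (controlledSum T N) := by
  refine IsRealTrigPolyOfDegreeLE.sum _ fun j hj => ?_
  obtain ⟨h1, h2⟩ := Finset.mem_Icc.1 hj
  have := (h j h1 h2).mul (IsRealTrigPolyOfDegreeLE.cos_nat (2 ^ j))
  push_cast at this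
  refine this.mono ?_
  have h3 := four_mul_coeffDegree_le T j
  have h4 : 2 ^ j ≤ 2 ^ N := Nat.pow_le_pow_right (by norm_num) h2
  omega

theorem isRealTrigPolyOfDegreeLE_controlledCoeff (T : ℕ → ℝ) (j : ℕ) :
    IsRealTrigPolyOfDegreeLE (coeffDegree T j) (controlledCoeff T j) := by
  induction j using Nat.strong_induction_on with
  | _ j ih =>
    by_cases h : lookback T j = 0
    · rw [funext (controlledCoeff_of_lookback_eq_zero h)]
      exact .const _ _
    have hS := isRealTrigPolyOfDegreeLE_controlledSum_of_coeff (N := lookback T j)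
      fun i h1 h2 => ih i (lookback_lt h1 h2)
    have hu := (((hS.const_mul (80 * T j)⁻¹).pow 2).const_sub 1).polyCutoff (cutoffExponent j)
    rw [funext (controlledCoeff_eq T j)]
    simp only [div_eq_inv_mul]
    refine hu.mono ?_
    rw [coeffDegree, if_neg h]
    generalize lookback T j = m
    generalize cutoffExponent j = n
    have h1 : n ≤ 2 ^ n := Nat.lt_two_pow_self.le
    calc 2 ^ n * (n * (2 * (2 ^ m + 2 ^ m / 4))) ≤ 2 ^ n * (2 ^ n * (2 * (2 ^ m + 2 ^ m))) := by
          gcongr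
          exact Nat.div_le_self _ _
      _ = 2 ^ (m + 2 + 2 * n) := by ring

theorem isRealTrigPolyOfDegreeLE_controlledSum (T : ℕ → ℝ) (N : ℕ) :
    IsRealTrigPolyOfDegreeLE (2 ^ N + 2 ^ N / 4) (controlledSum T N) :=
  isRealTrigPolyOfDegreeLE_controlledSum_of_coeff fun j _ _ =>
    isRealTrigPolyOfDegreeLE_controlledCoeff T j

theorem one_sub_div_sq_mem {s t : ℝ} (ht : 0 < t) (h : |s| ≤ t) :
    0 ≤ 1 - (s / t) ^ 2 ∧ 1 - (s / t) ^ 2 ≤ 1 := by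
  have : |s / t| ≤ 1 := by rwa [abs_div, abs_of_pos ht, div_le_one ht]
  have := (sq_le_one_iff_abs_le_one _).2 this
  constructor
  · linarith
  · linarith [sq_nonneg (s / t)]

theorem abs_controlledSum_sub_le {x : ℝ} {m N : ℕ} (hmN : m ≤ N)
    (h : ∀ j, 1 ≤ j → j ≤ N → |controlledCoeff T j x| ≤ 1) :
    |controlledSum T N x| ≤ |controlledSum T m x| + ((N : ℝ) - m) := by
  induction N, hmN using Nat.le_induction with
  | base => simp
  | succ N hmN ih =>
    have h1 := ih fun j hj hjN => h j hj (by omega)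
    have h2 : |controlledCoeff T (N + 1) x * Real.cos ((2 : ℝ) ^ (N + 1) * x)| ≤ 1 := by
      rw [abs_mul]
      exact mul_le_one₀ (h _ (by omega) le_rfl) (abs_nonneg _) (Real.abs_cos_le_one _)
    rw [controlledSum_succ]
    push_cast
    linarith [abs_add_le (controlledSum T N x)
      (controlledCoeff T (N + 1) x * Real.cos ((2 : ℝ) ^ (N + 1) * x))]

/-- The growth conditions on the thresholds. -/
structure IsThreshold (T : ℕ → ℝ) : Prop where
  zero : T 0 = 0
  sqrt_le : ∀ j : ℕ, √(j : ℝ) ≤ T j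
  mono : Monotone T
  add_le : ∀ j, T j + 1 / (2 * √((j + 1 : ℕ) : ℝ)) ≤ T (j + 1)

/-! ### Uniform, mean-square and mean-value bounds -/

namespace IsThreshold

theorem one_le (hT : IsThreshold T) (j : ℕ) (hj : 1 ≤ j) : 1 ≤ T j :=
  (Real.one_le_sqrt.2 (by exact_mod_cast hj)).trans (hT.sqrt_le j)

theorem sub_lookback_le (hT : IsThreshold T) {j : ℕ} (hj : 1 ≤ j) :
    (j : ℝ) - lookback T j ≤ 10 * T j := by
  have h0 := hT.one_le j hj
  have h1 : j ≤ lookback T j + (⌈T j⌉₊ + 2 * (j.sqrt + 1) + 4) := by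
    unfold lookback cutoffExponent
    omega
  have h2 : (j : ℝ) ≤ lookback T j + (⌈T j⌉₊ + 2 * (j.sqrt + 1) + 4) := by exact_mod_cast h1
  have h3 := Nat.ceil_lt_add_one (zero_le_one.trans h0)
  have h4 : (j.sqrt : ℝ) ≤ T j := Real.nat_sqrt_le_real_sqrt.trans (hT.sqrt_le j)
  linarith

theorem half_pow_cutoffExponent_le {j : ℕ} (hj : 1 ≤ j) :
    (1 / 2 : ℝ) ^ cutoffExponent j ≤ 1 / √(j : ℝ) := by
  have h0 : 0 < √(j : ℝ) := Real.sqrt_pos.2 (by exact_mod_cast hj)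
  rw [one_div_pow]
  refine one_div_le_one_div_of_le h0 ?_
  have h1 : √(j : ℝ) ≤ (cutoffExponent j : ℝ) := by
    rw [cutoffExponent]
    push_cast
    exact Real.real_sqrt_le_nat_sqrt_succ
  have h2 : (cutoffExponent j : ℝ) ≤ 2 ^ cutoffExponent j := by
    exact_mod_cast Nat.lt_two_pow_self.le
  exact h1.trans h2

theorem abs_sum_lookback_le (hT : IsThreshold T) {x : ℝ} {j : ℕ} (hj : 1 ≤ j)
    (h : ∀ i < j, |controlledSum T i x| ≤ 80 * T i) :
    |controlledSum T (lookback T j) x| ≤ 80 * T j := by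
  have hlt : lookback T j < j := by
    unfold lookback
    omega
  exact (h _ hlt).trans (by linarith [hT.mono hlt.le])

theorem coeff_mem (hT : IsThreshold T) {x : ℝ} {j : ℕ} (hj : 1 ≤ j)
    (h : |controlledSum T (lookback T j) x| ≤ 80 * T j) :
    0 ≤ controlledCoeff T j x ∧ controlledCoeff T j x ≤ 1 := by
  have := one_sub_div_sq_mem (by linarith [hT.one_le j hj]) h
  rw [controlledCoeff_eq]
  exact ⟨polyCutoff_nonneg this.1 this.2, polyCutoff_le_one this.1 this.2⟩

theorem abs_sum_le (hT : IsThreshold T) (x : ℝ) (N : ℕ) :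
    |controlledSum T N x| ≤ 80 * T N := by
  induction N using Nat.strong_induction_on with
  | _ N ih =>
    rcases N with _ | N
    · simp [controlledSum_zero, hT.zero]
    have hm := hT.abs_sum_lookback_le (by omega) ih
    have hT1 := hT.one_le (N + 1) (by omega)
    -- The margin between 70 and 80 is the factor 10 of `sub_lookback_le`.
    rcases le_total |controlledSum T (lookback T (N + 1)) x| (70 * T (N + 1)) with hs | hs
    · have hc (j : ℕ) (h1 : 1 ≤ j) (h2 : j ≤ N + 1) : |controlledCoeff T j x| ≤ 1 := by
        have := hT.coeff_mem h1 (hT.abs_sum_lookback_le h1 fun i hi => ih i (by omega))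
        rw [abs_of_nonneg this.1]
        exact this.2
      have h1 := abs_controlledSum_sub_le (m := lookback T (N + 1)) (by unfold lookback; omega) hc
      linarith [hT.sub_lookback_le (j := N + 1) (by omega)]
    · have hu := one_sub_div_sq_mem (by linarith) hm
      -- Here 1 - (7/8)² = 15/64 < 1/4.
      have hle : 1 - (controlledSum T (lookback T (N + 1)) x / (80 * T (N + 1))) ^ 2 ≤ 1 / 4 := by
        have h1 : (7 / 8 : ℝ) ≤ |controlledSum T (lookback T (N + 1)) x / (80 * T (N + 1))| := by
          rw [abs_div, abs_of_pos (by linarith : 0 < 80 * T (N + 1)), le_div_iff₀ (by linarith)]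
          linarith
        rw [← sq_abs]
        nlinarith
      have hc : controlledCoeff T (N + 1) x ≤ 1 / √((N + 1 : ℕ) : ℝ) := by
        rw [controlledCoeff_eq]
        exact (polyCutoff_le_of_le hu.1 hle).trans (half_pow_cutoffExponent_le (by omega))
      have hterm : |controlledCoeff T (N + 1) x * Real.cos ((2 : ℝ) ^ (N + 1) * x)| ≤
          1 / √((N + 1 : ℕ) : ℝ) := by
        have h0 := (hT.coeff_mem (by omega) hm).1
        rw [abs_mul, abs_of_nonneg h0]
        exact (mul_le_of_le_one_right h0 (Real.abs_cos_le_one _)).trans hc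
      have hadd := hT.add_le N
      rw [← div_div, div_right_comm] at hadd
      have hpos : 0 ≤ 1 / √((N + 1 : ℕ) : ℝ) := by positivity
      rw [controlledSum_succ]
      linarith [ih N (by omega), abs_add_le (controlledSum T N x)
        (controlledCoeff T (N + 1) x * Real.cos ((2 : ℝ) ^ (N + 1) * x))]

theorem coeff_mem_Icc (hT : IsThreshold T) {j : ℕ} (hj : 1 ≤ j) (x : ℝ) :
    0 ≤ controlledCoeff T j x ∧ controlledCoeff T j x ≤ 1 :=
  hT.coeff_mem hj (hT.abs_sum_lookback_le hj fun i _ => hT.abs_sum_le x i)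

theorem integral_sum_sq_le (hT : IsThreshold T) (N : ℕ) :
    ∫ x, controlledSum T N x ^ 2 ∂normalizedMeasure ≤ N := by
  induction N with
  | zero => simp [controlledSum_zero]
  | succ N ih =>
    have hS := isRealTrigPolyOfDegreeLE_controlledSum T N
    have hp := isRealTrigPolyOfDegreeLE_controlledCoeff T (N + 1)
    have hSc := hS.continuous
    have hpc := hp.continuous
    have horth : ∫ x, controlledSum T N x * controlledCoeff T (N + 1) x *
        Real.cos ((2 : ℝ) ^ (N + 1) * x) ∂normalizedMeasure = 0 := by
      -- The degree is at most (5/4 + 1/2) · 2 ^ N < 2 ^ (N + 1).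
      have h := (hS.mul hp).integral_mul_cos_eq_zero (D := 2 ^ (N + 1)) (by
        have h1 := four_mul_coeffDegree_le T (N + 1)
        have h2 : 0 < 2 ^ N := by positivity
        rw [pow_succ] at h1 ⊢
        omega)
      push_cast at h
      exact h
    have hle (x : ℝ) : controlledSum T (N + 1) x ^ 2 ≤ (controlledSum T N x ^ 2 +
        2 * (controlledSum T N x * controlledCoeff T (N + 1) x *
          Real.cos ((2 : ℝ) ^ (N + 1) * x))) + 1 := by
      have h1 := hT.coeff_mem_Icc (j := N + 1) (by omega) x
      have h2 : (controlledCoeff T (N + 1) x * Real.cos ((2 : ℝ) ^ (N + 1) * x)) ^ 2 ≤ 1 := by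
        rw [sq_le_one_iff_abs_le_one, abs_mul, abs_of_nonneg h1.1]
        exact mul_le_one₀ h1.2 (abs_nonneg _) (Real.abs_cos_le_one _)
      rw [controlledSum_succ]
      linarith
    have hint {f : ℝ → ℝ} (hf : Continuous f) := integrable_normalizedMeasure_of_continuous hf
    calc ∫ x, controlledSum T (N + 1) x ^ 2 ∂normalizedMeasure
        ≤ ∫ x, (controlledSum T N x ^ 2 + 2 * (controlledSum T N x *
          controlledCoeff T (N + 1) x * Real.cos ((2 : ℝ) ^ (N + 1) * x))) + 1
            ∂normalizedMeasure := by
          refine integral_mono (hint ?_) (hint (by fun_prop)) hle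
          exact (isRealTrigPolyOfDegreeLE_controlledSum T (N + 1)).continuous.pow 2
      _ = ∫ x, controlledSum T N x ^ 2 ∂normalizedMeasure + 1 := by
          rw [integral_add (hint (by fun_prop)) (hint (by fun_prop)),
            integral_add (hint (by fun_prop)) (hint (by fun_prop)), integral_const_mul, horth]
          simp
      _ ≤ (N + 1 : ℕ) := by
          push_cast
          linarith

theorem half_le_integral_coeff (hT : IsThreshold T) {j : ℕ} (hj : 1 ≤ j) :
    1 / 2 ≤ ∫ x, controlledCoeff T j x ∂normalizedMeasure := by
  have hS := (isRealTrigPolyOfDegreeLE_controlledSum T (lookback T j)).continuous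
  have hT1 := hT.one_le j hj
  -- A Chebyshev-type minorant: 12/5 makes the left side vanish when the squared ratio is 1/4, so
  -- beyond that point nonnegativity suffices.
  have hle (x : ℝ) : 3 / 5 - 12 / 5 * (80 * T j)⁻¹ ^ 2 * controlledSum T (lookback T j) x ^ 2 ≤
      controlledCoeff T j x := by
    have h0 := (hT.coeff_mem_Icc hj x).1
    have hu := one_sub_div_sq_mem (by linarith)
      (hT.abs_sum_lookback_le hj fun i _ => hT.abs_sum_le x i)
    rw [mul_assoc, ← mul_pow, ← div_eq_inv_mul]
    rcases le_total ((controlledSum T (lookback T j) x / (80 * T j)) ^ 2) (1 / 4) with h | h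
    · have h1 := le_polyCutoff_of_le (n := cutoffExponent j) (Nat.succ_ne_zero _)
        (by linarith) hu.2
      rw [← controlledCoeff_eq] at h1
      linarith [sq_nonneg (controlledSum T (lookback T j) x / (80 * T j))]
    · linarith
  have hint {f : ℝ → ℝ} (hf : Continuous f) := integrable_normalizedMeasure_of_continuous hf
  have h1 := integral_mono (μ := normalizedMeasure) (hint (by fun_prop))
    (hint (isRealTrigPolyOfDegreeLE_controlledCoeff T j).continuous) hle
  rw [integral_sub (hint (by fun_prop)) (hint (by fun_prop)), integral_const_mul] at h1
  simp only [integral_const, probReal_univ, one_smul] at h1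
  refine le_trans ?_ h1
  have h2 : ∫ x, controlledSum T (lookback T j) x ^ 2 ∂normalizedMeasure ≤ T j ^ 2 := by
    have h3 : (lookback T j : ℝ) ≤ j := by
      exact_mod_cast (by unfold lookback; omega : lookback T j ≤ j)
    exact (hT.integral_sum_sq_le _).trans
      (h3.trans ((Real.sqrt_le_left (by linarith)).1 (hT.sqrt_le j)))
  have h3 : (80 * T j)⁻¹ ^ 2 * ∫ x, controlledSum T (lookback T j) x ^ 2 ∂normalizedMeasure ≤
      1 / 6400 := by
    calc _ ≤ (80 * T j)⁻¹ ^ 2 * T j ^ 2 := by gcongr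
      _ = 1 / 6400 := by
        field_simp
        norm_num
  rw [mul_assoc]
  linarith

end IsThreshold

end controlled

/-! ### Power thresholds and conclusion -/

theorem rpow_add_le_rpow_succ {α : ℝ} (h0 : 1 / 2 ≤ α) (h1 : α ≤ 1) (j : ℕ) :
    (j : ℝ) ^ α + 1 / (2 * √((j + 1 : ℕ) : ℝ)) ≤ ((j + 1 : ℕ) : ℝ) ^ α := by
  have hc : (0 : ℝ) < ((j + 1 : ℕ) : ℝ) := by positivity
  have hone : (1 : ℝ) ≤ ((j + 1 : ℕ) : ℝ) := by exact_mod_cast Nat.succ_pos j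
  set y : ℝ := ((j + 1 : ℕ) : ℝ) with hy
  have hj : (j : ℝ) = y * (1 + -y⁻¹) := by
    rw [mul_add, mul_neg, mul_inv_cancel₀ hc.ne', hy]
    push_cast
    ring
  have hinv : y⁻¹ ≤ 1 := inv_le_one_of_one_le₀ hone
  -- Bernoulli for exponents at most 1 gives an increment of at least `α * y ^ (α - 1)`, and `α ≥
  -- 1/2` finishes.
  have hb : (1 + -y⁻¹) ^ α ≤ 1 + α * -y⁻¹ :=
    rpow_one_add_le_one_add_mul_self (by linarith) (by linarith) h1
  have hsq : √y ≤ y ^ α := by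
    rw [Real.sqrt_eq_rpow]
    exact Real.rpow_le_rpow_of_exponent_le hone h0
  have hs : 0 < √y := Real.sqrt_pos.2 hc
  have hmain : 1 / (2 * √y) ≤ y ^ α * (α * y⁻¹) := by
    calc 1 / (2 * √y) = √y * (1 / 2 * y⁻¹) := by
          nth_rewrite 3 [← Real.mul_self_sqrt hc.le]
          field_simp
      _ ≤ y ^ α * (α * y⁻¹) := by gcongr
  rw [hj, Real.mul_rpow hc.le (by linarith)]
  nlinarith [mul_le_mul_of_nonneg_left hb (Real.rpow_nonneg hc.le α)]

theorem isThreshold_rpow {α : ℝ} (h0 : 1 / 2 ≤ α) (h1 : α ≤ 1) :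
    IsThreshold fun j : ℕ => (j : ℝ) ^ α where
  zero := by
    rw [Nat.cast_zero, Real.zero_rpow (by linarith)]
  sqrt_le j := by
    rcases Nat.eq_zero_or_pos j with rfl | hj
    · simpa using Real.rpow_nonneg le_rfl α
    · rw [Real.sqrt_eq_rpow]
      exact Real.rpow_le_rpow_of_exponent_le (by exact_mod_cast hj) h0
  mono i j hij := Real.rpow_le_rpow (by positivity) (by exact_mod_cast hij) (by linarith)
  add_le := rpow_add_le_rpow_succ h0 h1
theorem mainTheorem2 :
    ∃ cMinus cPlus C : ℝ, 0 < cMinus ∧ 0 < cPlus ∧ 0 < C ∧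
      ∀ ε : ℝ, 0 ≤ ε → ε < 1 →
        ∃ p : ℕ → ℝ → ℝ,
          (∀ j : ℕ, 1 ≤ j →
            IsRealTrigPoly (p j) ∧
            (trigDegree (p j) : ℝ) ≤ (2 : ℝ) ^ ((j : ℝ) - (j : ℝ) ^ ε) ∧
            ENNReal.ofReal cMinus ≤ trigNorm 1 (p j) ∧
            trigNorm 1 (p j) ≤ trigNorm ⊤ (p j) ∧
            trigNorm ⊤ (p j) ≤ ENNReal.ofReal cPlus) ∧
          ∀ N : ℕ, 1 ≤ N →
            trigNorm ⊤ (fun x : ℝ =>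
                ∑ j ∈ Finset.Icc 1 N, p j x * Real.cos ((2 : ℝ) ^ j * x))
              ≤ ENNReal.ofReal (C * (N : ℝ) ^ (max ε (1 / 2))) := by
  refine ⟨1 / 2, 1, 80, by norm_num, by norm_num, by norm_num, fun ε _ hε1 => ?_⟩
  -- The exponent ε serves the degree bound; 1/2 serves the mean-square bound and the cost of the
  -- cutoff's degree.
  set T : ℕ → ℝ := fun j => (j : ℝ) ^ max ε (1 / 2)
  have hT : IsThreshold T := isThreshold_rpow (le_max_right _ _) (max_le hε1.le (by norm_num))
  refine ⟨controlledCoeff T, fun j hj => ?_, fun N _ => trigNorm_top_le (hT.abs_sum_le · N)⟩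
  have hp := isRealTrigPolyOfDegreeLE_controlledCoeff T j
  refine ⟨⟨_, hp⟩, ?_, ?_, trigNorm_one_le_trigNorm_top hp.continuous, ?_⟩
  · have hdeg : (trigDegree (controlledCoeff T j) : ℝ) ≤ coeffDegree T j := by
      exact_mod_cast Nat.sInf_le hp
    refine (hdeg.trans (coeffDegree_le T j)).trans
      (Real.rpow_le_rpow_of_exponent_le one_le_two (sub_le_sub_left ?_ _))
    exact Real.rpow_le_rpow_of_exponent_le (by exact_mod_cast hj) (le_max_left _ _)
  · exact (ENNReal.ofReal_le_ofReal (hT.half_le_integral_coeff hj)).trans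
      (ofReal_integral_le_trigNorm_one _)
  · refine trigNorm_top_le fun x => ?_
    have h := hT.coeff_mem_Icc hj x
    rw [abs_of_nonneg h.1]
    exact h.2
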